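/- Let $\Phi$ be a root system of type $B_n$ or $D_n$ with $\Phi^+=\{\varepsilon_i\pm\varepsilon_j \mid 1\le i<j\le n\}\cup\{\varepsilon_i\mid 1\le i\le n\}$ for $B_n$ and $\Phi^+=\{\varepsilon_i\pm\varepsilon_j\mid 1\le i<j\le n\}$ for $D_n$, and put $\mathrm{col}(\varepsilon_i\pm\varepsilon_j)=\mathrm{col}(\varepsilon_i)=i$, $\mathrm{row}(\varepsilon_i\pm\varepsilon_j)=\mp j$, $\mathrm{row}(\varepsilon_i)=0$. Let $\mathbb F_q$ be a finite field of odd characteristic $p\ge n$, and let $m=2n+1$ (for $B_n$) or $m=2n$ (for $D_n$); number the rows and columns of $m\times m$ matrices by $1,\dots,n,0,-n,\dots,-1$ (without $0$ for $D_n$). Let $\mathfrak u$ be the space of strictly lower triangular $m\times m$ matrices over $\mathbb F_q$ that are skew-symmetric with respect to the antidiagonal; it has the basis $e_{\varepsilon_i}=e_{0,i}-e_{-i,0}$, $e_{\varepsilon_i-\varepsilon_j}=e_{j,i}-e_{-i,-j}$, $e_{\varepsilon_i+\varepsilon_j}=e_{-j,i}-e_{-i,j}$, with dual basis $(e_\alpha^*)_{\alpha\in\Phi^+}$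 of $\mathfrak u^*$. Let $U$ be the group of lower unitriangular matrices over $\mathbb F_q$ preserving the symmetric bilinear form whose matrix has units on the antidiagonal and zeros elsewhere. It acts on $\mathfrak u^*$ by the coadjoint action $(g.f)(x)=f(g^{-1}xg)$, and the dimension of a coadjoint orbit $\Omega$ is defined by $|\Omega|=q^{\dim\Omega}$. An *orthogonal rook placement* is a set $D\subset\Phi^+$ of pairwise orthogonal roots with at most one root in each row and in each column. Write $D=\{\beta_1,\dots,\beta_t\}$ with $\mathrm{col}(\beta_1)<\dots<\mathrm{col}(\beta_t)$. The *battleship* $\mathcal F_D\colon\Phi^+\to\{\otimes,\bullet,+,-\}$ is defined as follows. First $\mathcal F_D(\beta)=\otimes$ for $\beta\in D$. Then, at the step $i=1,\dots,t$, put $\mathcal F_D(\gamma)=+$ and $\mathcal F_D(\delta)=-$ for all $\gamma,\delta\in\Phi^+$ such that $\gamma+\delta=\beta_i$, $\mathrm{col}(\gamma)=\mathrm{col}(\beta_i)$, and neither $\gamma$ nor $\delta$ was mapped to $-$ at an earlier step. Finally, $\mathcal F_D(\alpha)=\bullet$ for all other roots $\alpha$. Let $D\subset\Phi^+$ be an orthogonal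 rook placement, let $\xi=(\xi_\beta)_{\beta\in D}$ be non-zero elements of $\mathbb F_q$, and let $\Omega=\Omega_{D,\xi}\subset\mathfrak u^*$ be the coadjoint orbit of $f=\sum_{\beta\in D}\xi_\beta e_\beta^*$. Then $$\dim\Omega=\#\{\alpha\in\Phi^+\mid \mathcal F_D(\alpha)\in\{+,-\}\}=2\cdot\#\{\alpha\in\Phi^+\mid\mathcal F_D(\alpha)=-\}.$$ -/

import Mathlib

namespace OrthRook

/-- The two series of orthogonal root systems `B_n`, `D_n`. -/
inductive RootType where
  | B
  | D

/-- The size of the matrices: `m = 2n+1` for `B_n` and `m = 2n` for `D_n`. -/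
def size : RootType → ℕ → ℕ
  | .B, n => 2 * n + 1
  | .D, n => 2 * n

/-- Positive roots (indices are 0-based: `i : Fin n` stands for the index `i+1`):
`sub i j = ε_i - ε_j`, `add i j = ε_i + ε_j` for `i < j`, and, for `B_n` only, `short i = ε_i`. -/
inductive PosRoot (n : ℕ) : RootType → Type where
  | sub {T : RootType} (i j : Fin n) (h : i < j) : PosRoot n T
  | add {T : RootType} (i j : Fin n) (h : i < j) : PosRoot n T
  | short (i : Fin n) : PosRoot n .B

namespace PosRoot

variable {n : ℕ} {T : RootType}

/-- The root as a vector of `ℤⁿ ⊆ ℝⁿ`. -/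
def vec : PosRoot n T → (Fin n → ℤ)
  | sub i j _ => Pi.single i 1 - Pi.single j 1
  | add i j _ => Pi.single i 1 + Pi.single j 1
  | short i => Pi.single i 1

/-- The column: `col (ε_i ± ε_j) = col ε_i = i`. -/
def col : PosRoot n T → Fin n
  | sub i _ _ => i
  | add i _ _ => i
  | short i => i

/-- The row: `row (ε_i ± ε_j) = ∓ j`, `row ε_i = 0` (with the 1-based value of `j`). -/
def row : PosRoot n T → ℤ
  | sub _ j _ => (j : ℤ) + 1
  | add _ j _ => -((j : ℤ) + 1)
  | short _ => 0

end PosRoot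

instance instFinitePosRoot (n : ℕ) (T : RootType) : Finite (PosRoot n T) := by
  let φ : PosRoot n T → Fin n × ℤ := fun α => (α.col, α.row)
  have hφ : Function.Injective φ := by
    intro α β h
    cases α <;> cases β <;> simp [φ, PosRoot.col, PosRoot.row, Fin.ext_iff] at h ⊢ <;> omega
  have hr : ∀ α, φ α ∈ (Set.univ ×ˢ Set.Icc (-(n : ℤ)) n : Set (Fin n × ℤ)) := by
    intro α
    cases α <;> simp [φ, PosRoot.row] <;> omega
  have hfin : (Set.univ ×ˢ Set.Icc (-(n : ℤ)) n : Set (Fin n × ℤ)).Finite :=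
    Set.finite_univ.prod (Set.finite_Icc _ _)
  have := hfin.to_subtype
  exact Finite.of_injective (fun α => (⟨φ α, hr α⟩ :
    (Set.univ ×ˢ Set.Icc (-(n : ℤ)) n : Set (Fin n × ℤ))))
    (fun a b h => hφ (congrArg Subtype.val h))

/-- Pairwise orthogonal positive roots, at most one in each row and in each column. -/
def IsOrthogonalRookPlacement {n : ℕ} {T : RootType} (D : Finset (PosRoot n T)) : Prop :=
  ∀ α ∈ D, ∀ β ∈ D, α ≠ β →
    α.vec ⬝ᵥ β.vec = 0 ∧ α.row ≠ β.row ∧ α.col ≠ β.col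

/-! ### The battleship -/

/-- The symbols `⊗`, `•`, `+`, `-`. -/
inductive Symbol where
  | otimes
  | bullet
  | plus
  | minus

open Classical in
/-- The state of the filling after the columns with (0-based) number `< k` were treated; `bullet`
also marks the roots which are not filled yet. As `D` has at most one root in each column, going
through the columns from left to right is going through `D = {β₁, …, β_t}` with
`col β₁ < … < col β_t`. For `β ∈ D` in the current column, each pair `γ + δ = β` with
`col γ = col β`, neither member of which is already a minus, gets `γ ↦ +`, `δ ↦ -`. -/
noncomputable def battleshipAux {n : ℕ} {T : RootType} (D : Finset (PosRoot n T)) :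
    ℕ → PosRoot n T → Symbol
  | 0, α => if α ∈ D then .otimes else .bullet
  | k + 1, α =>
    let IsPair (γ δ : PosRoot n T) : Prop :=
      (∃ β ∈ D, (β.col : ℕ) = k ∧ γ.vec + δ.vec = β.vec ∧ γ.col = β.col) ∧
        battleshipAux D k γ ≠ .minus ∧ battleshipAux D k δ ≠ .minus
    if ∃ δ, IsPair α δ then .plus
    else if ∃ γ, IsPair γ α then .minus
    else battleshipAux D k α

/-- The battleship `𝓕_D : Φ⁺ → {⊗, •, +, -}`. -/
noncomputable def battleship {n : ℕ} {T : RootType} (D : Finset (PosRoot n T)) :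
    PosRoot n T → Symbol :=
  battleshipAux D n

/-! ### The Lie algebra `𝔲` and the group `U`

Rows and columns of `m × m` matrices are numbered by `1, 2, …, n, 0, -n, …, -2, -1` (no `0` for
`D_n`), in this order; this list is identified with `Fin m`, so that `a ↦ -a` is `Fin.rev`. -/

/-- The matrix index `i`, `1 ≤ i ≤ n`. -/
def pos {n : ℕ} (T : RootType) (i : Fin n) : Fin (size T n) :=
  ⟨i, by cases T <;> simp only [size] <;> omega⟩

/-- The matrix index `-i`, `1 ≤ i ≤ n`. -/
def neg {n : ℕ} (T : RootType) (i : Fin n) : Fin (size T n) := (pos T i).rev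

/-- The matrix index `0` (type `B_n` only). -/
def zero (n : ℕ) : Fin (size .B n) := ⟨n, by simp only [size]; omega⟩

/-- The root vectors `e_{ε_i} = e_{0,i} - e_{-i,0}`, `e_{ε_i-ε_j} = e_{j,i} - e_{-i,-j}`,
`e_{ε_i+ε_j} = e_{-j,i} - e_{-i,j}`. -/
def rootVector (F : Type*) [Field F] {n : ℕ} : {T : RootType} → PosRoot n T →
    Matrix (Fin (size T n)) (Fin (size T n)) F
  | T, .sub i j _ => Matrix.single (pos T j) (pos T i) 1 - Matrix.single (neg T i) (neg T j) 1
  | T, .add i j _ => Matrix.single (neg T j) (pos T i) 1 - Matrix.single (neg T i) (pos T j) 1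
  | _, .short i => Matrix.single (zero n) (pos .B i) 1 - Matrix.single (neg .B i) (zero n) 1

/-- `𝔲`: the strictly lower triangular matrices which are skew-symmetric with respect to the
antidiagonal. -/
def nilradical (F : Type*) [Field F] (T : RootType) (n : ℕ) :
    Submodule F (Matrix (Fin (size T n)) (Fin (size T n)) F) where
  carrier := {x | (∀ a b, a ≤ b → x a b = 0) ∧ ∀ a b, x b.rev a.rev = -x a b}
  add_mem' := by
    rintro x y ⟨hx, hx'⟩ ⟨hy, hy'⟩
    refine ⟨fun a b h => by simp [hx a b h, hy a b h], fun a b => ?_⟩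
    simp only [Matrix.add_apply, hx', hy']; ring
  zero_mem' := by simp
  smul_mem' := by
    rintro c x ⟨hx, hx'⟩
    refine ⟨fun a b h => by simp [hx a b h], fun a b => ?_⟩
    simp only [Matrix.smul_apply, hx', smul_eq_mul]; ring

section RootSpaces

variable {F : Type*} [Field F] {n : ℕ} {T : RootType}

/-- The place of the first unit of `e_α`: its row, as a matrix index. -/
def rowIdx : {T : RootType} → PosRoot n T → Fin (size T n)
  | T, .sub _ j _ => pos T j
  | T, .add _ j _ => neg T j
  | _, .short _ => zero n

/-- The place of the first unit of `e_α`: its column, as a matrix index. -/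
def colIdx (α : PosRoot n T) : Fin (size T n) := pos T α.col

theorem pos_val (i : Fin n) : (pos T i : ℕ) = i := rfl

theorem neg_val (i : Fin n) : (neg T i : ℕ) = size T n - (i + 1) := Fin.val_rev _

theorem zero_val : (zero n : ℕ) = n := rfl

theorem rev_neg (i : Fin n) : (neg T i).rev = pos T i := Fin.rev_rev _

theorem rev_zero : (zero n).rev = zero n := by
  ext; simp [zero, size]; omega

theorem rootVector_eq (α : PosRoot n T) : rootVector F α =
    Matrix.single (rowIdx α) (colIdx α) 1 - Matrix.single (colIdx α).rev (rowIdx α).rev 1 := by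
  cases α <;> simp [rootVector, rowIdx, colIdx, PosRoot.col, rev_neg, rev_zero] <;> rfl

theorem colIdx_lt_rowIdx (α : PosRoot n T) :
    colIdx α < rowIdx α ∧ rowIdx α < (colIdx α).rev := by
  rw [Fin.lt_def, Fin.lt_def, Fin.val_rev]
  cases α with
  | sub i j h =>
    rw [Fin.lt_def] at h
    simp only [rowIdx, colIdx, PosRoot.col, pos_val]
    cases T <;> simp only [size] <;> omega
  | add i j h =>
    rw [Fin.lt_def] at h
    simp only [rowIdx, colIdx, PosRoot.col, pos_val, neg_val]
    cases T <;> simp only [size] <;> omega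
  | short i =>
    simp only [rowIdx, colIdx, PosRoot.col, pos_val, zero_val, size]
    omega

theorem idx_injective {α β : PosRoot n T} (hr : rowIdx α = rowIdx β)
    (hc : colIdx α = colIdx β) : α = β := by
  rw [Fin.ext_iff] at hr hc
  cases α with
  | sub i j h =>
    cases β with
    | sub i' j' h' =>
      simp only [rowIdx, colIdx, PosRoot.col, pos_val, ← Fin.ext_iff] at hr hc
      subst hr hc; rfl
    | add i' j' h' =>
      simp only [rowIdx, colIdx, PosRoot.col, pos_val, neg_val] at hr hc
      cases T <;> simp only [size] at hr <;> omega
    | short i' =>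
      simp only [rowIdx, colIdx, PosRoot.col, pos_val, zero_val] at hr hc
      omega
  | add i j h =>
    cases β with
    | sub i' j' h' =>
      simp only [rowIdx, colIdx, PosRoot.col, pos_val, neg_val] at hr hc
      cases T <;> simp only [size] at hr <;> omega
    | add i' j' h' =>
      simp only [rowIdx, colIdx, PosRoot.col, pos_val, neg_val] at hr hc
      have hi : i = i' := Fin.ext hc
      have hj : j = j' := Fin.ext (by cases T <;> simp only [size] at hr <;> omega)
      subst hi hj; rfl
    | short i' =>
      simp only [rowIdx, colIdx, PosRoot.col, pos_val, neg_val, zero_val, size] at hr hc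
      omega
  | short i =>
    cases β with
    | sub i' j' h' =>
      simp only [rowIdx, colIdx, PosRoot.col, pos_val, zero_val] at hr hc
      omega
    | add i' j' h' =>
      simp only [rowIdx, colIdx, PosRoot.col, pos_val, neg_val, zero_val, size] at hr hc
      omega
    | short i' =>
      simp only [colIdx, PosRoot.col, pos_val, ← Fin.ext_iff] at hc
      subst hc; rfl

theorem exists_root_of_lt (r c : Fin (size T n)) (h : c < r) (h' : r < c.rev) :
    ∃ α : PosRoot n T, rowIdx α = r ∧ colIdx α = c := by
  rw [Fin.lt_def] at h h'
  rw [Fin.val_rev] at h'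
  have hc : (c : ℕ) < n := by cases T <;> simp only [size] at h' <;> omega
  rcases lt_or_ge (r : ℕ) n with hn | hn
  · exact ⟨.sub ⟨c, hc⟩ ⟨r, hn⟩ h, rfl, rfl⟩
  · by_cases hz : (r : ℕ) = n ∧ size T n = 2 * n + 1
    · cases T with
      | B => exact ⟨.short ⟨c, hc⟩, Fin.ext hz.1.symm, rfl⟩
      | D => simp only [size] at hz; omega
    · have hr := r.2
      have hm : size T n = 2 * n + 1 ∨ size T n = 2 * n := by
        cases T
        · exact Or.inl rfl
        · exact Or.inr rfl
      have hs : size T n - (r + 1) < n := by omega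
      have hlt : (c : ℕ) < size T n - (r + 1) := by omega
      refine ⟨.add ⟨c, hc⟩ ⟨size T n - (r + 1), hs⟩ hlt, Fin.ext ?_, Fin.ext ?_⟩
      · simp only [rowIdx, neg_val]
        omega
      · rfl

theorem rootVector_mem (α : PosRoot n T) : rootVector F α ∈ nilradical F T n := by
  have h := colIdx_lt_rowIdx α
  rw [rootVector_eq]
  refine ⟨fun a b hab => ?_, fun a b => ?_⟩
  · simp only [Matrix.sub_apply, Matrix.single_apply]
    rw [if_neg, if_neg, sub_zero]
    · rintro ⟨rfl, rfl⟩
      exact absurd (Fin.rev_lt_rev.2 h.1) (not_lt.2 hab)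
    · rintro ⟨rfl, rfl⟩
      exact absurd h.1 (not_lt.2 hab)
  · have e1 : (rowIdx α = b.rev ∧ colIdx α = a.rev) ↔
        ((colIdx α).rev = a ∧ (rowIdx α).rev = b) := by
      rw [← Fin.rev_inj (i := rowIdx α), ← Fin.rev_inj (i := colIdx α), Fin.rev_rev, Fin.rev_rev]
      exact and_comm
    have e2 : ((colIdx α).rev = b.rev ∧ (rowIdx α).rev = a.rev) ↔
        (rowIdx α = a ∧ colIdx α = b) := by
      rw [Fin.rev_inj, Fin.rev_inj]
      exact and_comm
    simp only [Matrix.sub_apply, Matrix.single_apply, e1, e2]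
    ring

/-- The linear form `e_α^*` on `𝔲`. -/
def dualVector (F : Type*) [Field F] {n : ℕ} {T : RootType} (α : PosRoot n T) :
    Module.Dual F (nilradical F T n) where
  toFun x := x.1 (rowIdx α) (colIdx α)
  map_add' _ _ := rfl
  map_smul' _ _ := rfl

open Classical in
/-- The forms `e_α^*` are dual to the vectors `e_α`. -/
theorem dualVector_rootVector (α β : PosRoot n T) :
    dualVector F α ⟨rootVector F β, rootVector_mem β⟩ = if α = β then 1 else 0 := by
  have ha := colIdx_lt_rowIdx α
  have hb := colIdx_lt_rowIdx β
  show rootVector F β (rowIdx α) (colIdx α) = _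
  rw [rootVector_eq]
  simp only [Matrix.sub_apply, Matrix.single_apply]
  rw [if_neg (c := (colIdx β).rev = _ ∧ _), sub_zero]
  · refine if_congr ⟨fun h => (idx_injective h.1 h.2).symm, ?_⟩ rfl rfl
    rintro rfl
    exact ⟨rfl, rfl⟩
  · rintro ⟨h1, h2⟩
    rw [← h1, ← h2, Fin.rev_rev] at ha
    exact absurd ha.2 (not_lt.2 hb.2.le)

/-- In characteristic `≠ 2`, `𝔲` is the span of the vectors `e_α`, `α ∈ Φ⁺`. -/
theorem nilradical_eq_span (h2 : (2 : F) ≠ 0) : nilradical F T n =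
    Submodule.span F (Set.range (rootVector F : PosRoot n T → _)) := by
  classical
  apply le_antisymm
  · intro x hx
    have : Fintype (PosRoot n T) := Fintype.ofFinite _
    let S : nilradical F T n := ∑ α : PosRoot n T,
      dualVector F α ⟨x, hx⟩ • ⟨rootVector F α, rootVector_mem α⟩
    have key : ∀ y : nilradical F T n, (∀ α, dualVector F α y = 0) → y = 0 := by
      rintro ⟨y, hy, hy'⟩ h
      have hup : ∀ a b : Fin (size T n), a < b.rev → y a b = 0 := by
        intro a b hab
        rcases le_or_gt a b with hle | hlt
        · exact hy a b hle
        · obtain ⟨α, rfl, rfl⟩ := exists_root_of_lt a b hlt hab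
          exact h α
      ext a b
      show y a b = 0
      rcases lt_trichotomy a b.rev with hl | rfl | hg
      · exact hup a b hl
      · have := hy' b.rev b
        rw [Fin.rev_rev] at this
        have h3 : 2 * y b.rev b = 0 := by linear_combination this
        exact (mul_eq_zero.1 h3).resolve_left h2
      · have := hup b.rev a.rev (by rw [Fin.rev_rev]; exact hg)
        rw [hy'] at this
        exact neg_eq_zero.1 this
    have hS : (⟨x, hx⟩ : nilradical F T n) - S = 0 := by
      apply key
      intro α
      simp only [S, map_sub, map_sum, map_smul, dualVector_rootVector, smul_eq_mul, mul_ite,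
        mul_one, mul_zero, Finset.sum_ite_eq, Finset.mem_univ, if_true, sub_self]
    have hxS : x = (S : Matrix (Fin (size T n)) (Fin (size T n)) F) :=
      congrArg Subtype.val (sub_eq_zero.1 hS)
    rw [hxS]
    simp only [S, Submodule.coe_sum, Submodule.coe_smul]
    exact Submodule.sum_mem _ fun α _ =>
      Submodule.smul_mem _ _ (Submodule.subset_span ⟨α, rfl⟩)
  · rw [Submodule.span_le]
    rintro _ ⟨α, rfl⟩
    exact rootVector_mem α

end RootSpaces

/-- The matrix of the symmetric form: units on the antidiagonal. -/
def antidiag (F : Type*) [Field F] (m : ℕ) : Matrix (Fin m) (Fin m) F :=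
  Matrix.of fun a b => if b = a.rev then 1 else 0

section Group

variable {F : Type*} [Field F]

theorem mul_antidiag_apply {m : ℕ} (g : Matrix (Fin m) (Fin m) F) (a b : Fin m) :
    (g * antidiag F m) a b = g a b.rev := by
  have h' : ∀ c : Fin m, (b = c.rev) = (c = b.rev) := fun c =>
    propext ⟨fun h => by rw [h, Fin.rev_rev], fun h => by rw [h, Fin.rev_rev]⟩
  simp only [Matrix.mul_apply, antidiag, Matrix.of_apply, h', mul_ite, mul_one, mul_zero,
    Finset.sum_ite_eq', Finset.mem_univ, if_true]

theorem antidiag_mul_apply {m : ℕ} (g : Matrix (Fin m) (Fin m) F) (a b : Fin m) :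
    (antidiag F m * g) a b = g a.rev b := by
  simp [antidiag, Matrix.mul_apply]

theorem antidiag_mul_self (m : ℕ) : antidiag F m * antidiag F m = 1 := by
  ext a b
  rw [antidiag_mul_apply, antidiag, Matrix.of_apply, Fin.rev_rev, Matrix.one_apply]
  exact if_congr eq_comm rfl rfl

theorem antidiag_conj_transpose {m : ℕ} (g : Matrix (Fin m) (Fin m) F) (a b : Fin m) :
    (antidiag F m * g.transpose * antidiag F m) a b = g b.rev a.rev := by
  rw [mul_antidiag_apply, antidiag_mul_apply, Matrix.transpose_apply]

/-- Lower triangular matrices with units on the diagonal. -/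
def IsLowerUnitriangular {m : ℕ} (g : Matrix (Fin m) (Fin m) F) : Prop :=
  (∀ a b, a < b → g a b = 0) ∧ ∀ a, g a a = 1

theorem IsLowerUnitriangular.mul {m : ℕ} {g h : Matrix (Fin m) (Fin m) F}
    (hg : IsLowerUnitriangular g) (hh : IsLowerUnitriangular h) :
    IsLowerUnitriangular (g * h) := by
  refine ⟨fun a b hab => ?_, fun a => ?_⟩
  · rw [Matrix.mul_apply]
    refine Finset.sum_eq_zero fun c _ => ?_
    rcases lt_or_ge a c with h1 | h1
    · rw [hg.1 a c h1, zero_mul]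
    · rw [hh.1 c b (lt_of_le_of_lt h1 hab), mul_zero]
  · rw [Matrix.mul_apply, Finset.sum_eq_single a, hg.2, hh.2, one_mul]
    · intro c _ hc
      rcases lt_or_gt_of_ne hc with h1 | h1
      · rw [hh.1 c a h1, mul_zero]
      · rw [hg.1 a c h1, zero_mul]
    · simp

theorem inv_eq_of_orthogonal {m : ℕ} (g : GL (Fin m) F)
    (hg : g.1 * antidiag F m * g.1.transpose = antidiag F m) :
    (g⁻¹).1 = antidiag F m * g.1.transpose * antidiag F m := by
  have h : g.1 * (antidiag F m * g.1.transpose * antidiag F m) = 1 := by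
    rw [← mul_assoc, ← mul_assoc, hg, antidiag_mul_self]
  exact Units.inv_eq_of_mul_eq_one_right h

end Group

/-- The maximal unipotent subgroup `U` of the orthogonal group: the lower unitriangular matrices
which preserve the symmetric form with units on the antidiagonal. -/
def unipotentGroup (F : Type*) [Field F] (T : RootType) (n : ℕ) :
    Subgroup (GL (Fin (size T n)) F) where
  carrier := {g | IsLowerUnitriangular g.1 ∧
    g.1 * antidiag F (size T n) * g.1.transpose = antidiag F (size T n)}
  mul_mem' := by
    rintro g h ⟨hg, hg'⟩ ⟨hh, hh'⟩
    refine ⟨hg.mul hh, ?_⟩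
    show g.1 * h.1 * antidiag F (size T n) * (g.1 * h.1).transpose = antidiag F (size T n)
    rw [Matrix.transpose_mul]
    calc g.1 * h.1 * antidiag F (size T n) * (h.1.transpose * g.1.transpose)
        = g.1 * (h.1 * antidiag F (size T n) * h.1.transpose) * g.1.transpose := by
          simp only [mul_assoc]
      _ = _ := by rw [hh', hg']
  one_mem' := by
    refine ⟨⟨fun a b h => ?_, fun a => ?_⟩, ?_⟩
    · simp [h.ne]
    · simp
    · simp
  inv_mem' := by
    rintro g ⟨hg, hg'⟩
    have hi := inv_eq_of_orthogonal g hg'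
    refine ⟨⟨fun a b h => ?_, fun a => ?_⟩, ?_⟩
    · rw [hi, antidiag_conj_transpose]
      exact hg.1 _ _ (Fin.rev_lt_rev.2 h)
    · rw [hi, antidiag_conj_transpose]
      exact hg.2 _
    · have h1 : (g⁻¹).1 * g.1 = 1 := g.inv_mul
      have h2 : g.1.transpose * (g⁻¹).1.transpose = 1 := by
        rw [← Matrix.transpose_mul, h1, Matrix.transpose_one]
      calc (g⁻¹).1 * antidiag F (size T n) * (g⁻¹).1.transpose
          = (g⁻¹).1 * (g.1 * antidiag F (size T n) * g.1.transpose) * (g⁻¹).1.transpose := by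
            rw [hg']
        _ = ((g⁻¹).1 * g.1) * antidiag F (size T n) *
              (g.1.transpose * (g⁻¹).1.transpose) := by simp only [mul_assoc]
        _ = _ := by rw [h1, h2, one_mul, mul_one]

section Action

variable {F : Type*} [Field F] {T : RootType} {n : ℕ}

theorem conj_mem (g : unipotentGroup F T n) {x : Matrix (Fin (size T n)) (Fin (size T n)) F}
    (hx : x ∈ nilradical F T n) : g.1.1 * x * (g⁻¹).1.1 ∈ nilradical F T n := by
  obtain ⟨g, hg, hg'⟩ := g
  obtain ⟨hx, hx'⟩ := hx
  have hi := inv_eq_of_orthogonal g hg'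
  have hi' : ∀ a b, (g⁻¹).1 a b = g.1 b.rev a.rev := fun a b => by
    rw [hi, antidiag_conj_transpose]
  show g.1 * x * (g⁻¹).1 ∈ _
  refine ⟨fun a b hab => ?_, fun a b => ?_⟩
  · rw [Matrix.mul_apply]
    refine Finset.sum_eq_zero fun c _ => ?_
    rw [Matrix.mul_apply, Finset.sum_mul]
    refine Finset.sum_eq_zero fun d _ => ?_
    rcases lt_or_ge a d with h1 | h1
    · rw [hg.1 a d h1, zero_mul, zero_mul]
    · rcases le_or_gt d c with h3 | h3
      · rw [hx d c h3, mul_zero, zero_mul]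
      · have : c < b := lt_of_lt_of_le h3 (h1.trans hab)
        rw [hi', hg.1 _ _ (Fin.rev_lt_rev.2 this), mul_zero]
  · simp only [Matrix.mul_apply, Finset.sum_mul, ← Finset.sum_neg_distrib]
    rw [Finset.sum_comm, ← Equiv.sum_comp Fin.revPerm]
    refine Finset.sum_congr rfl fun c _ => ?_
    rw [← Equiv.sum_comp Fin.revPerm]
    refine Finset.sum_congr rfl fun d _ => ?_
    simp only [Fin.revPerm_apply, hi', hx', Fin.rev_rev]
    ring

/-- The adjoint action `x ↦ g x g⁻¹` of `U` on `𝔲`. -/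
def adjointRep (F : Type*) [Field F] (T : RootType) (n : ℕ) :
    Representation F (unipotentGroup F T n) (nilradical F T n) where
  toFun g :=
    { toFun := fun x => ⟨g.1.1 * x.1 * (g⁻¹).1.1, conj_mem g x.2⟩
      map_add' := fun x y => Subtype.ext (by simp [mul_add, add_mul])
      map_smul' := fun c x => Subtype.ext (by simp) }
  map_one' := by
    ext x : 2
    simp
  map_mul' g h := by
    ext x : 2
    simp [mul_assoc]

/-- The coadjoint orbit of a linear form: `(g.f)(x) = f(g⁻¹ x g)`. -/
def coadjointOrbit (f : Module.Dual F (nilradical F T n)) :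
    Set (Module.Dual F (nilradical F T n)) :=
  Set.range fun g : unipotentGroup F T n => (adjointRep F T n).dual g f

/-- The dimension of a coadjoint orbit over the finite field `F = 𝔽_q`, given by
`|Ω| = q ^ dim Ω`. -/
noncomputable def orbitDim (Ω : Set (Module.Dual F (nilradical F T n))) : ℝ :=
  Real.logb (Nat.card F) Ω.ncard

/-- The canonical form `f_{D,ξ} = ∑_{β ∈ D} ξ_β e_β^*`. -/
def canonicalForm (D : Finset (PosRoot n T)) (ξ : PosRoot n T → F) :
    Module.Dual F (nilradical F T n) :=
  ∑ β ∈ D, ξ β • dualVector F β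

end Action

end OrthRook

/-!
The orbit of a form `f` has the same size as `𝔲 / rad B_f`, where `B_f (x, y) = f ([x, y])`; here no
exponential map is needed, because the Cayley transform `y ↦ (1 + y) (1 - y)⁻¹` is a bijection from
`𝔲` to `U` which carries the radical of `B_f` onto the stabilizer of `f`. Indeed, for
`g = (1 + y) (1 - y)⁻¹` and `x = (1 + y) z (1 - y)` one has `g⁻¹ x g - x = 2 [z, y]`, and `x` runs
over `𝔲` when `z` does (`cayley_stabilizes_iff`, `ncard_coadjointOrbit_mul`).

It remains to compute the rank of `B_f` for `f = f_{D,ξ}`. In the basis of root vectors,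
`B_f (e_γ, e_δ)` is non-zero only if `γ + δ ∈ D`, and then it is non-zero
(`exists_add_eq_of_bracket_ne_zero`, `bracket_ne_zero`). The battleship reads off a matching in the
graph with edges `{γ, δ}`, `γ + δ ∈ D`:
* the minuses cover all edges, since the pairs of a step not having a minus yet receive one
  (`minus_of_add_mem`);
* each minus `δ` has a plus partner `π δ`, and any other minus adjacent to `π δ` was placed at an
  earlier step than `δ` (`IsSumPair.eq_or_step_lt`).

So the matrix of `B_f` vanishes off the rows and columns of the minuses, while the block of the
pluses against the minuses is triangular with non-zero diagonal. Hence the rank is twice the number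
of minuses (`finrank_ker_of_matched_cover`), and there are as many pluses as minuses
(`ncard_plus_eq_ncard_minus`).
-/

namespace OrthRook

open Matrix OrderDual

/-! ### The transpose with respect to the antidiagonal -/

section AntiTranspose

variable {F : Type*} [Field F] {m : ℕ}

/-- The transpose of `x` with respect to the antidiagonal, an anti-automorphism of the matrix ring:
`𝔲` is its `-1`-eigenspace on strictly lower triangular matrices, and it sends `g ∈ U` to
`g⁻¹`. -/
def antiTranspose (x : Matrix (Fin m) (Fin m) F) : Matrix (Fin m) (Fin m) F :=
  antidiag F m * x.transpose * antidiag F m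

theorem antiTranspose_apply (x : Matrix (Fin m) (Fin m) F) (a b : Fin m) :
    antiTranspose x a b = x b.rev a.rev :=
  antidiag_conj_transpose x a b

theorem antiTranspose_antiTranspose (x : Matrix (Fin m) (Fin m) F) :
    antiTranspose (antiTranspose x) = x := by
  ext a b
  simp [antiTranspose_apply]

theorem antiTranspose_mul (x y : Matrix (Fin m) (Fin m) F) :
    antiTranspose (x * y) = antiTranspose y * antiTranspose x := by
  simp only [antiTranspose, Matrix.transpose_mul]
  calc _ = antidiag F m * yᵀ * 1 * xᵀ * antidiag F m := by simp [mul_assoc]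
    _ = _ := by rw [← antidiag_mul_self]; simp only [mul_assoc]

theorem antiTranspose_add (x y : Matrix (Fin m) (Fin m) F) :
    antiTranspose (x + y) = antiTranspose x + antiTranspose y := by
  simp [antiTranspose, mul_add, add_mul]

theorem antiTranspose_sub (x y : Matrix (Fin m) (Fin m) F) :
    antiTranspose (x - y) = antiTranspose x - antiTranspose y := by
  simp [antiTranspose, mul_sub, sub_mul]

theorem antiTranspose_one : antiTranspose (1 : Matrix (Fin m) (Fin m) F) = 1 := by
  simp [antiTranspose, antidiag_mul_self]

theorem antiTranspose_inv (x : Matrix (Fin m) (Fin m) F) (hx : IsUnit x.det) :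
    antiTranspose x⁻¹ = (antiTranspose x)⁻¹ := by
  refine (Matrix.inv_eq_right_inv ?_).symm
  rw [← antiTranspose_mul, Matrix.nonsing_inv_mul _ hx, antiTranspose_one]

theorem mul_antidiag_mul_transpose_iff (g : Matrix (Fin m) (Fin m) F) :
    g * antidiag F m * g.transpose = antidiag F m ↔ g * antiTranspose g = 1 := by
  constructor
  · intro h
    rw [antiTranspose, ← mul_assoc, ← mul_assoc, h, antidiag_mul_self]
  · intro h
    have := congrArg (· * antidiag F m) h
    simpa [antiTranspose, mul_assoc, antidiag_mul_self] using this

theorem antiTranspose_lower {x : Matrix (Fin m) (Fin m) F} (hx : x.IsLowerTriangular) :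
    (antiTranspose x).IsLowerTriangular := by
  intro a b hab
  rw [antiTranspose_apply]
  exact hx (Fin.rev_lt_rev.2 hab)

theorem lower_mul_strict {x y : Matrix (Fin m) (Fin m) F} (hx : x.IsLowerTriangular)
    (hy : ∀ a b, a ≤ b → y a b = 0) : ∀ a b, a ≤ b → (x * y) a b = 0 := by
  intro a b hab
  rw [Matrix.mul_apply]
  refine Finset.sum_eq_zero fun c _ => ?_
  rcases lt_or_ge a c with h | h
  · rw [hx h, zero_mul]
  · rw [hy c b (h.trans hab), mul_zero]

theorem strict_mul_lower {x y : Matrix (Fin m) (Fin m) F} (hx : ∀ a b, a ≤ b → x a b = 0)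
    (hy : y.IsLowerTriangular) : ∀ a b, a ≤ b → (x * y) a b = 0 := by
  intro a b hab
  rw [Matrix.mul_apply]
  refine Finset.sum_eq_zero fun c _ => ?_
  rcases lt_or_ge c b with h | h
  · rw [hy h, mul_zero]
  · rw [hx a c (hab.trans h), zero_mul]

theorem lower_of_strict {x : Matrix (Fin m) (Fin m) F} (hx : ∀ a b, a ≤ b → x a b = 0) :
    x.IsLowerTriangular :=
  fun a b hab => hx a b (le_of_lt hab)

theorem inv_lower {x : Matrix (Fin m) (Fin m) F} (hx : x.IsLowerTriangular)
    (hu : IsUnit x.det) : x⁻¹.IsLowerTriangular := by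
  have := Matrix.invertibleOfIsUnitDet x hu
  exact Matrix.blockTriangular_inv_of_blockTriangular hx

end AntiTranspose

/-! ### The Cayley transform and the size of a coadjoint orbit -/

section Cayley

variable {F : Type*} [Field F] {T : RootType} {n : ℕ}

theorem mem_nilradical_iff {x : Matrix (Fin (size T n)) (Fin (size T n)) F} :
    x ∈ nilradical F T n ↔ (∀ a b, a ≤ b → x a b = 0) ∧ antiTranspose x = -x := by
  refine and_congr Iff.rfl ⟨fun h => ?_, fun h a b => ?_⟩
  · ext a b
    rw [antiTranspose_apply, h, Matrix.neg_apply]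
  · rw [← Matrix.neg_apply, ← h]
    exact (antiTranspose_apply x a b).symm

theorem commutator_mem {x y : Matrix (Fin (size T n)) (Fin (size T n)) F}
    (hx : x ∈ nilradical F T n) (hy : y ∈ nilradical F T n) :
    x * y - y * x ∈ nilradical F T n := by
  rw [mem_nilradical_iff] at *
  refine ⟨fun a b hab => ?_, ?_⟩
  · rw [Matrix.sub_apply, lower_mul_strict (lower_of_strict hx.1) hy.1 a b hab,
      lower_mul_strict (lower_of_strict hy.1) hx.1 a b hab, sub_zero]
  · rw [antiTranspose_sub, antiTranspose_mul, antiTranspose_mul, hx.2, hy.2]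
    noncomm_ring

/-- With `g = 1 + y`, `y ∈ 𝔲`, this says that `z ↦ (1 + y) z (1 - y)` preserves `𝔲`. -/
theorem mul_mul_antiTranspose_mem {g x : Matrix (Fin (size T n)) (Fin (size T n)) F}
    (hg : g.IsLowerTriangular) (hx : x ∈ nilradical F T n) :
    g * x * antiTranspose g ∈ nilradical F T n := by
  rw [mem_nilradical_iff] at *
  refine ⟨strict_mul_lower (lower_mul_strict hg hx.1) (antiTranspose_lower hg), ?_⟩
  rw [antiTranspose_mul, antiTranspose_mul, antiTranspose_antiTranspose, hx.2]
  noncomm_ring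

theorem one_add_lower {y : Matrix (Fin (size T n)) (Fin (size T n)) F}
    (hy : y ∈ nilradical F T n) : (1 + y).IsLowerTriangular :=
  Matrix.blockTriangular_one.add (lower_of_strict hy.1)

theorem det_one_add {y : Matrix (Fin (size T n)) (Fin (size T n)) F}
    (hy : y ∈ nilradical F T n) : IsUnit (1 + y).det := by
  rw [Matrix.det_of_isLowerTriangular _ (one_add_lower hy)]
  simp [hy.1 _ _ le_rfl]

theorem antiTranspose_one_add {y : Matrix (Fin (size T n)) (Fin (size T n)) F}
    (hy : y ∈ nilradical F T n) : antiTranspose (1 + y) = 1 - y := by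
  rw [antiTranspose_add, antiTranspose_one, (mem_nilradical_iff.1 hy).2, sub_eq_add_neg]

theorem antiTranspose_one_sub {y : Matrix (Fin (size T n)) (Fin (size T n)) F}
    (hy : y ∈ nilradical F T n) : antiTranspose (1 - y) = 1 + y := by
  rw [← antiTranspose_one_add hy, antiTranspose_antiTranspose]

theorem one_sub_lower {y : Matrix (Fin (size T n)) (Fin (size T n)) F}
    (hy : y ∈ nilradical F T n) : (1 - y).IsLowerTriangular := by
  rw [sub_eq_add_neg]
  exact one_add_lower (neg_mem hy)

theorem det_one_sub {y : Matrix (Fin (size T n)) (Fin (size T n)) F}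
    (hy : y ∈ nilradical F T n) : IsUnit (1 - y).det := by
  rw [sub_eq_add_neg]
  exact det_one_add (neg_mem hy)

theorem one_add_mul_one_sub_comm {R : Type*} [Ring R] (y : R) :
    (1 + y) * (1 - y) = (1 - y) * (1 + y) := by
  noncomm_ring

theorem one_add_mul_inv_one_sub {y : Matrix (Fin (size T n)) (Fin (size T n)) F}
    (hB : IsUnit (1 - y).det) : (1 + y) * (1 - y)⁻¹ = (1 - y)⁻¹ * (1 + y) := by
  calc (1 + y) * (1 - y)⁻¹ = (1 - y)⁻¹ * ((1 - y) * (1 + y)) * (1 - y)⁻¹ := by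
        rw [Matrix.nonsing_inv_mul_cancel_left _ _ hB]
    _ = (1 - y)⁻¹ * (1 + y) := by
        rw [← one_add_mul_one_sub_comm, ← mul_assoc, Matrix.mul_nonsing_inv_cancel_right _ _ hB]

/-- The Cayley transform `y ↦ (1 + y) (1 - y)⁻¹` from `𝔲` to `U`. -/
noncomputable def cayley (y : nilradical F T n) : unipotentGroup F T n :=
  ⟨⟨(1 + y.1) * (1 - y.1)⁻¹, (1 - y.1) * (1 + y.1)⁻¹, by
      rw [mul_assoc, Matrix.nonsing_inv_mul_cancel_left _ _ (det_one_sub y.2),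
        Matrix.mul_nonsing_inv _ (det_one_add y.2)], by
      rw [mul_assoc, Matrix.nonsing_inv_mul_cancel_left _ _ (det_one_add y.2),
        Matrix.mul_nonsing_inv _ (det_one_sub y.2)]⟩, by
    have hA := det_one_add y.2
    have hB := det_one_sub y.2
    have hstrict : ∀ a b, a ≤ b → ((1 + y.1) * (1 - y.1)⁻¹ - 1) a b = 0 := by
      have h : (1 + y.1) * (1 - y.1)⁻¹ - 1 = (y.1 + y.1) * (1 - y.1)⁻¹ := by
        rw [show y.1 + y.1 = 1 + y.1 - (1 - y.1) by abel, sub_mul, Matrix.mul_nonsing_inv _ hB]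
      rw [h]
      exact strict_mul_lower (add_mem y.2 y.2).1 (inv_lower (one_sub_lower y.2) hB)
    refine ⟨⟨fun a b hab => ?_, fun a => ?_⟩, (mul_antidiag_mul_transpose_iff _).2 ?_⟩
    · simpa [hab.ne] using hstrict a b hab.le
    · simpa [sub_eq_zero] using hstrict a a le_rfl
    · show (1 + y.1) * (1 - y.1)⁻¹ * antiTranspose ((1 + y.1) * (1 - y.1)⁻¹) = 1
      rw [antiTranspose_mul, antiTranspose_inv _ hB, antiTranspose_one_add y.2,
        antiTranspose_one_sub y.2, mul_assoc, ← mul_assoc (1 - y.1)⁻¹, ← Matrix.mul_inv_rev,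
        one_add_mul_one_sub_comm, Matrix.mul_inv_rev, mul_assoc,
        Matrix.nonsing_inv_mul _ hB, mul_one, Matrix.mul_nonsing_inv _ hA]⟩

theorem coe_cayley (y : nilradical F T n) : (cayley y).1.1 = (1 + y.1) * (1 - y.1)⁻¹ := rfl

theorem coe_cayley_inv (y : nilradical F T n) :
    ((cayley y)⁻¹).1.1 = (1 - y.1) * (1 + y.1)⁻¹ := rfl

theorem det_unipotent_add_one (h2 : (2 : F) ≠ 0) (g : unipotentGroup F T n) :
    IsUnit (g.1.1 + 1).det := by
  have hl : (g.1.1 + 1).IsLowerTriangular :=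
    Matrix.BlockTriangular.add (fun a b hab => g.2.1.1 a b hab) Matrix.blockTriangular_one
  rw [Matrix.det_of_isLowerTriangular _ hl]
  simp only [Matrix.add_apply, g.2.1.2, Matrix.one_apply_eq, one_add_one_eq_two]
  simp [h2]

/-- The inverse is `g ↦ (g - 1) (g + 1)⁻¹`; `g + 1` is invertible because its diagonal entries
are `2`. -/
theorem cayley_bijective (h2 : (2 : F) ≠ 0) :
    Function.Bijective (cayley : nilradical F T n → unipotentGroup F T n) := by
  constructor
  · intro y z hyz
    have key : ∀ y : nilradical F T n,
        ((cayley y).1.1 + 1) * y.1 = (cayley y).1.1 - 1 := by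
      intro y
      have h : (cayley y).1.1 * (1 - y.1) = 1 + y.1 := by
        rw [coe_cayley, mul_assoc, Matrix.nonsing_inv_mul _ (det_one_sub y.2), mul_one]
      rw [mul_sub, mul_one, sub_eq_iff_eq_add] at h
      rw [add_mul, one_mul]
      rw [eq_sub_iff_add_eq]
      exact (by abel : _ = 1 + y.1 + (cayley y).1.1 * y.1).trans h.symm
    have hu := det_unipotent_add_one h2 (cayley y)
    have h := key y
    rw [hyz, ← key z, ← hyz] at h
    have := congrArg (((cayley y).1.1 + 1)⁻¹ * ·) h
    simp only [Matrix.nonsing_inv_mul_cancel_left _ _ hu] at this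
    exact Subtype.ext this
  · intro g
    have hu := det_unipotent_add_one h2 g
    set h := (g.1.1 + 1)⁻¹ with hh
    have h1 : (g.1.1 + 1) * h = 1 := Matrix.mul_nonsing_inv _ hu
    have h1' : h * (g.1.1 + 1) = 1 := Matrix.nonsing_inv_mul _ hu
    have hg : g.1.1 * antiTranspose g.1.1 = 1 := (mul_antidiag_mul_transpose_iff _).1 g.2.2
    have hg' : antiTranspose g.1.1 * g.1.1 = 1 := mul_eq_one_comm.1 hg
    have hl : (g.1.1 + 1).IsLowerTriangular :=
      Matrix.BlockTriangular.add (fun a b hab => g.2.1.1 a b hab) Matrix.blockTriangular_one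
    have hy : (g.1.1 - 1) * h ∈ nilradical F T n := by
      rw [mem_nilradical_iff]
      constructor
      · refine strict_mul_lower (fun a b hab => ?_) (inv_lower hl hu)
        rcases hab.eq_or_lt with rfl | hab
        · simp [g.2.1.2]
        · simp [g.2.1.1 _ _ hab, hab.ne]
      · have hs : antiTranspose h * (antiTranspose g.1.1 + 1) = 1 := by
          rw [← antiTranspose_one, ← antiTranspose_add, ← antiTranspose_mul, h1, antiTranspose_one]
        have e : (antiTranspose g.1.1 - 1) * (g.1.1 + 1) =
            -((antiTranspose g.1.1 + 1) * (g.1.1 - 1)) := by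
          simp only [mul_add, add_mul, mul_sub, sub_mul, hg', one_mul, mul_one]
          abel
        rw [antiTranspose_mul, antiTranspose_sub, antiTranspose_one]
        calc antiTranspose h * (antiTranspose g.1.1 - 1)
            = antiTranspose h * ((antiTranspose g.1.1 - 1) * (g.1.1 + 1)) * h := by
              rw [mul_assoc, mul_assoc, h1, mul_one]
          _ = -(antiTranspose h * (antiTranspose g.1.1 + 1) * (g.1.1 - 1) * h) := by
              rw [e]; noncomm_ring
          _ = _ := by rw [hs, one_mul]
    refine ⟨⟨_, hy⟩, Subtype.ext (Units.ext ?_)⟩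
    have hB := det_one_sub hy
    have e : g.1.1 * (1 - (g.1.1 - 1) * h) = 1 + (g.1.1 - 1) * h := by
      have e1 : g.1.1 * h = 1 - h := by
        rw [eq_sub_iff_add_eq, ← h1, add_mul, one_mul]
      simp only [sub_mul, one_mul, e1, mul_sub, mul_one]
      abel
    rw [coe_cayley, ← e, mul_assoc, Matrix.mul_nonsing_inv _ hB, mul_one]

/-- The alternating form `B_f (x, y) = f ([x, y])` on `𝔲`. -/
def bracketForm (f : Module.Dual F (nilradical F T n)) :
    nilradical F T n →ₗ[F] nilradical F T n →ₗ[F] F :=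
  LinearMap.mk₂ F (fun x y => f ⟨x.1 * y.1 - y.1 * x.1, commutator_mem x.2 y.2⟩)
    (fun x x' y => by rw [← map_add]; congr 1; ext1; simp [add_mul, mul_add]; abel)
    (fun c x y => by rw [← map_smul]; congr 1; ext1; simp [smul_sub])
    (fun x y y' => by rw [← map_add]; congr 1; ext1; simp [add_mul, mul_add]; abel)
    (fun c x y => by rw [← map_smul]; congr 1; ext1; simp [smul_sub])

theorem bracketForm_apply (f : Module.Dual F (nilradical F T n)) (x y : nilradical F T n) :
    bracketForm f x y = f ⟨x.1 * y.1 - y.1 * x.1, commutator_mem x.2 y.2⟩ := rfl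

/-- The substitution `x = (1 + y) z (1 - y)` makes the stabilizer condition linear in `y`. -/
theorem cayley_stabilizes_iff (h2 : (2 : F) ≠ 0) (f : Module.Dual F (nilradical F T n))
    (y : nilradical F T n) :
    (adjointRep F T n).dual (cayley y) f = f ↔ ∀ z, bracketForm f z y = 0 := by
  have hA := det_one_add y.2
  have hB := det_one_sub y.2
  let tw (z : nilradical F T n) : nilradical F T n :=
    ⟨(1 + y.1) * z.1 * (1 - y.1), by
      rw [← antiTranspose_one_add y.2]
      exact mul_mul_antiTranspose_mem (one_add_lower y.2) z.2⟩
  have key : ∀ z, (adjointRep F T n).dual (cayley y) f (tw z) - f (tw z) =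
      2 * bracketForm f z y := by
    intro z
    have e : (cayley y)⁻¹.1.1 * (tw z).1 * (((cayley y)⁻¹)⁻¹).1.1 =
        (1 - y.1) * z.1 * (1 + y.1) := by
      rw [inv_inv, coe_cayley_inv, coe_cayley, one_add_mul_inv_one_sub hB]
      show (1 - y.1) * (1 + y.1)⁻¹ * ((1 + y.1) * z.1 * (1 - y.1)) * ((1 - y.1)⁻¹ * (1 + y.1)) = _
      calc _ = (1 - y.1) * ((1 + y.1)⁻¹ * (1 + y.1)) * z.1 * ((1 - y.1) * (1 - y.1)⁻¹) *
            (1 + y.1) := by simp only [mul_assoc]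
        _ = _ := by
          rw [Matrix.nonsing_inv_mul _ hA, Matrix.mul_nonsing_inv _ hB, mul_one, mul_one]
    have e' : adjointRep F T n (cayley y)⁻¹ (tw z) - tw z =
        (2 : F) • (⟨z.1 * y.1 - y.1 * z.1, commutator_mem z.2 y.2⟩ : nilradical F T n) := by
      apply Subtype.ext
      show (cayley y)⁻¹.1.1 * (tw z).1 * (((cayley y)⁻¹)⁻¹).1.1 -
        (1 + y.1) * z.1 * (1 - y.1) = (2 : F) • (z.1 * y.1 - y.1 * z.1)
      rw [e, two_smul]
      noncomm_ring
    rw [bracketForm_apply, ← smul_eq_mul, ← map_smul, ← e', map_sub]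
    rfl
  have hsurj : Function.Surjective tw := by
    intro x
    refine ⟨⟨(1 + y.1)⁻¹ * x.1 * (1 - y.1)⁻¹, ?_⟩, Subtype.ext ?_⟩
    · rw [← antiTranspose_one_add y.2, ← antiTranspose_inv _ hA]
      exact mul_mul_antiTranspose_mem (inv_lower (one_add_lower y.2) hA) x.2
    · show (1 + y.1) * ((1 + y.1)⁻¹ * x.1 * (1 - y.1)⁻¹) * (1 - y.1) = x.1
      calc _ = ((1 + y.1) * (1 + y.1)⁻¹) * x.1 * ((1 - y.1)⁻¹ * (1 - y.1)) := by
            simp only [mul_assoc]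
        _ = _ := by
          rw [Matrix.nonsing_inv_mul _ hB, Matrix.mul_nonsing_inv _ hA, mul_one, one_mul]
  constructor
  · intro h z
    have := key z
    rw [h, sub_self] at this
    exact (mul_eq_zero.1 this.symm).resolve_left h2
  · intro h
    ext x
    obtain ⟨z, rfl⟩ := hsurj x
    rw [← sub_eq_zero, key, h, mul_zero]

/-- Orbit-stabilizer, with `U` and the stabilizer of `f` replaced by `𝔲` and the radical of `B_f`
through the Cayley transform. -/
theorem ncard_coadjointOrbit_mul [Finite F] (h2 : (2 : F) ≠ 0)
    (f : Module.Dual F (nilradical F T n)) :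
    (coadjointOrbit f).ncard * Nat.card (LinearMap.ker (bracketForm f).flip) =
      Nat.card (nilradical F T n) := by
  let _ : MulAction (unipotentGroup F T n) (Module.Dual F (nilradical F T n)) :=
    MulAction.compHom _ (adjointRep F T n).dual
  have hsmul : ∀ g : unipotentGroup F T n, g • f = (adjointRep F T n).dual g f := fun g => rfl
  have e1 : Nat.card (LinearMap.ker (bracketForm f).flip) =
      Nat.card (MulAction.stabilizer (unipotentGroup F T n) f) := by
    refine Nat.card_congr (Equiv.subtypeEquiv (Equiv.ofBijective _ (cayley_bijective h2)) ?_)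
    intro y
    rw [MulAction.mem_stabilizer_iff, hsmul, Equiv.ofBijective_apply, cayley_stabilizes_iff h2,
      LinearMap.mem_ker, LinearMap.ext_iff]
    rfl
  have e2 : (coadjointOrbit f).ncard = Nat.card (MulAction.orbit (unipotentGroup F T n) f) := rfl
  rw [e1, e2, Nat.card_congr (Equiv.ofBijective _ (cayley_bijective h2)), ← Nat.card_prod]
  exact Nat.card_congr (MulAction.orbitProdStabilizerEquivGroup _ f)

end Cayley

/-! ### The rank of a skew-symmetric matrix with a matched vertex cover -/

section SkewMatrix

theorem mulVec_injective_of_triangular {F ι : Type*} [Field F] [Fintype ι] [DecidableEq ι]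
    (A : Matrix ι ι F) (s : ι → ℕ) (hdiag : ∀ i, A i i ≠ 0)
    (htri : ∀ i j, A i j ≠ 0 → j = i ∨ s j < s i) : Function.Injective A.mulVec := by
  refine (injective_iff_map_eq_zero A.mulVecLin).2 fun y hy => ?_
  have key : ∀ k i, s i = k → y i = 0 := by
    intro k
    induction k using Nat.strong_induction_on with
    | _ k ih =>
      rintro i rfl
      have h : ∑ j, A i j * y j = 0 := congrFun hy i
      rw [Finset.sum_eq_single i] at h
      · exact (mul_eq_zero.1 h).resolve_left (hdiag i)
      · intro j _ hj
        by_cases hA : A i j = 0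
        · rw [hA, zero_mul]
        · rw [ih _ ((htri i j hA).resolve_left hj) j rfl, mul_zero]
      · simp
  exact funext fun i => key _ i rfl

/-- View `M` as a skew-symmetric adjacency matrix on `V`. If the vertex cover `N` is matched into
its complement by `π`, and the block of `M` with rows `π d` and columns `d' ∈ N` is triangular with
non-zero diagonal for the order given by `s`, then `M` has rank `2 * #N`. -/
theorem finrank_ker_of_matched_cover {F V : Type*} [Field F] [Fintype V] [DecidableEq V]
    (M : Matrix V V F) (hskew : ∀ a b, M a b = -M b a) (N : Finset V)
    (hcover : ∀ a b, a ∉ N → b ∉ N → M a b = 0) (π : N → V) (hπ : ∀ d, π d ∉ N) (s : N → ℕ)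
    (hdiag : ∀ d, M (π d) d ≠ 0) (htri : ∀ d d' : N, M (π d) d' ≠ 0 → d' = d ∨ s d' < s d) :
    Module.finrank F (LinearMap.ker M.mulVecLin) + 2 * N.card = Fintype.card V := by
  let A : Matrix N N F := Matrix.of fun d d' => M (π d) d'
  have hA : Function.Injective A.mulVec := mulVec_injective_of_triangular A s hdiag htri
  have hA' : Function.Surjective Aᵀ.mulVec := by
    rw [Matrix.mulVec_surjective_iff_isUnit, Matrix.isUnit_transpose,
      ← Matrix.mulVec_injective_iff_isUnit]
    exact hA
  -- The kernel of `M` is that of `L : y ↦ (y|_N, (M y)|_N)`, and `L` is onto.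
  let L : (V → F) →ₗ[F] (N → F) × (N → F) :=
    LinearMap.prod (LinearMap.funLeft F F Subtype.val)
      (LinearMap.funLeft F F Subtype.val ∘ₗ M.mulVecLin)
  have hL1 : ∀ y d, (L y).1 d = y d := fun _ _ => rfl
  have hL2 : ∀ y d, (L y).2 d = ∑ b, M d b * y b := fun _ _ => rfl
  have hker : LinearMap.ker L = LinearMap.ker M.mulVecLin := by
    ext y
    simp only [LinearMap.mem_ker]
    constructor
    · intro h
      ext a
      show ∑ b, M a b * y b = 0
      by_cases ha : a ∈ N
      · rw [← hL2 y ⟨a, ha⟩, h]; rfl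
      · refine Finset.sum_eq_zero fun b _ => ?_
        by_cases hb : b ∈ N
        · rw [← hL1 y ⟨b, hb⟩, h]; exact mul_zero _
        · rw [hcover a b ha hb, zero_mul]
    · intro h
      have h' : ∀ a, ∑ b, M a b * y b = 0 := fun a => congrFun h a
      refine Prod.ext (hA ?_) (funext fun d => h' d)
      ext d
      have : A.mulVec (L y).1 d = ∑ b, M (π d) b * y b := by
        show ∑ d' : N, M (π d) d' * y d' = _
        rw [Finset.sum_coe_sort N (fun b => M (π d) b * y b)]
        refine Finset.sum_subset (Finset.subset_univ _) fun b _ hb => ?_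
        rw [hcover _ _ (hπ d) hb, zero_mul]
      rw [this, h']
      simp
  have hsurj : LinearMap.range L = ⊤ := by
    rw [LinearMap.range_eq_top]
    rintro ⟨u, v⟩
    let y₀ : V → F := fun b => if h : b ∈ N then u ⟨b, h⟩ else 0
    -- A vector supported on the image of `π` vanishes on `N`, so adding it keeps `y|_N = u`.
    obtain ⟨c, hc⟩ := hA' ((L y₀).2 - v)
    refine ⟨y₀ + ∑ d : N, c d • Pi.single (π d) 1, Prod.ext (funext fun d => ?_)
      (funext fun d => ?_)⟩
    · rw [hL1, Pi.add_apply, Finset.sum_apply, Finset.sum_eq_zero, add_zero]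
      · simp [y₀]
      · intro d' _
        have : (d : V) ≠ π d' := fun h => hπ d' (h ▸ d.2)
        simp [this]
    · have h1 : ∀ e : N, (L (Pi.single (π e) 1)).2 d = -M (π e) d := by
        intro e
        rw [hL2, ← hskew]
        simp [Pi.single_apply]
      have h2 : ∑ e, M (π e) d * c e = (L y₀).2 d - v d := congrFun hc d
      rw [map_add, map_sum, Prod.snd_add, Pi.add_apply, Prod.snd_sum, Finset.sum_apply]
      simp only [map_smul, Prod.smul_snd, Pi.smul_apply, h1, smul_eq_mul]
      have h3 : ∑ e, c e * -M (π e) d = -((L y₀).2 d - v d) := by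
        rw [← h2, ← Finset.sum_neg_distrib]
        exact Finset.sum_congr rfl fun e _ => by ring
      rw [h3]
      ring
  have := L.finrank_range_add_finrank_ker
  rw [hsurj, hker, finrank_top, Module.finrank_prod, Module.finrank_fintype_fun_eq_card,
    Module.finrank_fintype_fun_eq_card, Fintype.card_coe] at this
  omega

end SkewMatrix

/-! ### Weights of the matrix indices and brackets of root vectors -/

section Weights

variable {F : Type*} [Field F] {T : RootType} {n : ℕ}

/-- The weight of a matrix index for the diagonal torus: `ε_k` for the index `k`, `-ε_k` for `-k`,
and `0` for the index `0`. The matrix unit at `(a, b)` has weight `weight b - weight a`. -/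
def weight (a : Fin (size T n)) (k : Fin n) : ℤ :=
  (if a = pos T k then 1 else 0) - (if a = neg T k then 1 else 0)

theorem pos_ne_neg (i j : Fin n) : pos T i ≠ neg T j := by
  intro h
  rw [Fin.ext_iff, pos_val, neg_val] at h
  cases T <;> simp only [size] at h <;> omega

theorem pos_injective : Function.Injective (pos T : Fin n → _) := fun i j h => by
  rw [Fin.ext_iff, pos_val, pos_val] at h
  exact Fin.ext h

theorem weight_pos (i : Fin n) : weight (pos T i) = Pi.single i 1 := by
  ext k
  simp only [weight, pos_injective.eq_iff, if_neg (pos_ne_neg i k), Pi.single_apply,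
    eq_comm (a := i), sub_zero]

theorem weight_rev (a : Fin (size T n)) : weight a.rev = -weight a := by
  ext k
  have h1 : a.rev = pos T k ↔ a = neg T k := by rw [neg, Fin.rev_eq_iff]
  have h2 : a.rev = neg T k ↔ a = pos T k := by rw [neg, Fin.rev_inj]
  simp only [weight, h1, h2, Pi.neg_apply, neg_sub]

theorem weight_neg (i : Fin n) : weight (neg T i) = -Pi.single i 1 := by
  rw [neg, weight_rev, weight_pos]

theorem weight_zero : weight (zero n) = 0 := by
  have h : weight (zero n) = -weight (zero n) := by rw [← weight_rev, rev_zero]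
  exact self_eq_neg.1 h

theorem PosRoot.vec_eq_weight_sub (α : PosRoot n T) :
    α.vec = weight (colIdx α) - weight (rowIdx α) := by
  cases α with
  | sub i j h => simp only [PosRoot.vec, colIdx, rowIdx, PosRoot.col, weight_pos]
  | add i j h =>
    simp only [PosRoot.vec, colIdx, rowIdx, PosRoot.col, weight_pos, weight_neg, sub_neg_eq_add]
  | short i =>
    simp only [PosRoot.vec, colIdx, rowIdx, PosRoot.col, weight_pos, weight_zero, sub_zero]

/-- The last case is the index `0` of type `B_n`, characterized without reference to the type as the
only index fixed by `Fin.rev`. -/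
theorem idx_cases (a : Fin (size T n)) :
    (∃ k, a = pos T k) ∨ (∃ k, a = neg T k) ∨
      (a.rev = a ∧ ∀ b : Fin (size T n), b.rev = b → b = a) := by
  have ha := a.2
  have hm : size T n = 2 * n + 1 ∨ size T n = 2 * n := by
    cases T
    · exact Or.inl rfl
    · exact Or.inr rfl
  rcases lt_or_ge (a : ℕ) n with h | h
  · exact Or.inl ⟨⟨a, h⟩, Fin.ext rfl⟩
  · right
    by_cases h' : size T n - (a + 1) < n
    · exact Or.inl ⟨⟨size T n - (a + 1), h'⟩, Fin.ext (by rw [neg_val]; dsimp only; omega)⟩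
    · refine Or.inr ⟨Fin.ext (by rw [Fin.val_rev]; omega), fun b hb => Fin.ext ?_⟩
      rw [Fin.ext_iff, Fin.val_rev] at hb
      omega

theorem weight_eq_one_iff (a : Fin (size T n)) (k : Fin n) : weight a k = 1 ↔ a = pos T k := by
  have := pos_ne_neg (T := T) k k
  unfold weight
  split_ifs <;> simp_all

theorem weight_eq_neg_one_iff (a : Fin (size T n)) (k : Fin n) :
    weight a k = -1 ↔ a = neg T k := by
  have := pos_ne_neg (T := T) k k
  unfold weight
  split_ifs <;> simp_all

theorem weight_mem (a : Fin (size T n)) (k : Fin n) : -1 ≤ weight a k ∧ weight a k ≤ 1 := by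
  unfold weight
  split_ifs <;> simp

theorem weight_injective : Function.Injective (weight : Fin (size T n) → Fin n → ℤ) := by
  intro a b h
  rcases idx_cases a with ⟨k, rfl⟩ | ⟨k, rfl⟩ | ⟨_, ha'⟩
  · rw [eq_comm, ← weight_eq_one_iff, ← h, weight_eq_one_iff]
  · rw [eq_comm, ← weight_eq_neg_one_iff, ← h, weight_eq_neg_one_iff]
  · rcases idx_cases b with ⟨k, rfl⟩ | ⟨k, rfl⟩ | ⟨hb, _⟩
    · rw [← weight_eq_one_iff, h, weight_eq_one_iff]
    · rw [← weight_eq_neg_one_iff, h, weight_eq_neg_one_iff]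
    · exact (ha' b hb).symm

theorem eq_of_weight_add_eq_of_ne {x y z t : Fin (size T n)}
    (h : weight x + weight y = weight z + weight t) (hz : z ≠ t.rev) (hz' : z.rev ≠ z) :
    x = z ∧ y = t ∨ x = t ∧ y = z := by
  suffices hxy : x = z ∨ y = z by
    rcases hxy with rfl | rfl
    · exact Or.inl ⟨rfl, weight_injective (add_left_cancel h)⟩
    · rw [add_comm (weight y)] at h
      exact Or.inr ⟨weight_injective (add_right_cancel h), rfl⟩
  rcases idx_cases z with ⟨k, rfl⟩ | ⟨k, rfl⟩ | ⟨h0, _⟩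
  · have hk := congrFun h k
    simp only [Pi.add_apply] at hk
    rw [← weight_eq_one_iff, ← weight_eq_one_iff]
    have ht : weight t k ≠ -1 := by
      rw [Ne, weight_eq_neg_one_iff]
      rintro rfl
      exact hz (rev_neg k).symm
    have hz1 := (weight_eq_one_iff (pos T k) k).2 rfl
    have := weight_mem x k
    have := weight_mem y k
    have := weight_mem t k
    omega
  · have hk := congrFun h k
    simp only [Pi.add_apply] at hk
    rw [← weight_eq_neg_one_iff, ← weight_eq_neg_one_iff]
    have ht : weight t k ≠ 1 := by
      rw [Ne, weight_eq_one_iff]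
      rintro rfl
      exact hz rfl
    have hz1 := (weight_eq_neg_one_iff (neg T k) k).2 rfl
    have := weight_mem x k
    have := weight_mem y k
    have := weight_mem t k
    omega
  · exact absurd h0 hz'

/-- The matrix units of weight `δ` are exactly the two that occur in `e_δ`. -/
theorem PosRoot.eq_idx_of_weight_sub_eq (δ : PosRoot n T) {a b : Fin (size T n)}
    (h : weight b - weight a = δ.vec) :
    (a = rowIdx δ ∧ b = colIdx δ) ∨ (a = (colIdx δ).rev ∧ b = (rowIdx δ).rev) := by
  have hc := colIdx_lt_rowIdx δ
  have hw : weight b + weight a.rev = weight (colIdx δ) + weight (rowIdx δ).rev := by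
    rw [weight_rev, weight_rev, ← sub_eq_add_neg, ← sub_eq_add_neg, h, δ.vec_eq_weight_sub]
  rcases eq_of_weight_add_eq_of_ne hw (by rw [Fin.rev_rev]; exact hc.1.ne)
    (hc.1.trans hc.2).ne' with ⟨h1, h2⟩ | ⟨h1, h2⟩
  · exact Or.inl ⟨Fin.rev_injective h2, h1⟩
  · exact Or.inr ⟨by rw [← h2, Fin.rev_rev], h1⟩

theorem PosRoot.vec_col (α : PosRoot n T) : α.vec α.col = 1 := by
  cases α with
  | sub i j h => simp [PosRoot.vec, PosRoot.col, h.ne]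
  | add i j h => simp [PosRoot.vec, PosRoot.col, h.ne]
  | short i => simp [PosRoot.vec, PosRoot.col]

theorem PosRoot.vec_of_lt_col (α : PosRoot n T) {k : Fin n} (hk : k < α.col) : α.vec k = 0 := by
  cases α with
  | sub i j h =>
    have hk : k < i := hk
    simp [PosRoot.vec, hk.ne, (hk.trans h).ne]
  | add i j h =>
    have hk : k < i := hk
    simp [PosRoot.vec, hk.ne, (hk.trans h).ne]
  | short i =>
    have hk : k < i := hk
    simp [PosRoot.vec, hk.ne]

theorem PosRoot.col_eq_of_vec_eq {α β : PosRoot n T} (h : α.vec = β.vec) : α.col = β.col := by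
  by_contra hne
  rcases lt_or_gt_of_ne hne with hlt | hlt
  · have := α.vec_col
    rw [h, β.vec_of_lt_col hlt] at this
    exact zero_ne_one this
  · have := β.vec_col
    rw [← h, α.vec_of_lt_col hlt] at this
    exact zero_ne_one this

theorem PosRoot.vec_injective : Function.Injective (PosRoot.vec : PosRoot n T → _) := by
  intro α β h
  have hc : colIdx α = colIdx β := congrArg (pos T) (PosRoot.col_eq_of_vec_eq h)
  refine idx_injective (weight_injective ?_) hc
  rwa [α.vec_eq_weight_sub, β.vec_eq_weight_sub, hc, sub_right_inj] at h

/-- The column of a root is the place of its leading coefficient, which is `1`; hence the column of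
a sum of two roots which is a root is the smaller one, and it is attained only once. -/
theorem PosRoot.col_of_add_eq {γ δ β : PosRoot n T} (h : γ.vec + δ.vec = β.vec) :
    (γ.col = β.col ∧ β.col < δ.col) ∨ (δ.col = β.col ∧ β.col < γ.col) := by
  have hk : ∀ k, γ.vec k + δ.vec k = β.vec k := fun k => congrFun h k
  have hγ := γ.vec_col
  have hδ := δ.vec_col
  have hβ := β.vec_col
  rcases lt_trichotomy γ.col β.col with h1 | h1 | h1
  · have h2 := hk γ.col
    rw [hγ, β.vec_of_lt_col h1] at h2
    have h3 : ¬ γ.col < δ.col := fun h3 => by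
      rw [δ.vec_of_lt_col h3] at h2
      omega
    rcases (not_lt.1 h3).eq_or_lt with h4 | h4
    · rw [← h4, hδ] at h2
      omega
    · have h5 := hk δ.col
      rw [hδ, γ.vec_of_lt_col h4, β.vec_of_lt_col (h4.trans h1)] at h5
      omega
  · left
    refine ⟨h1, ?_⟩
    by_contra h3
    rcases (not_lt.1 h3).eq_or_lt with h4 | h4
    · have h5 := hk β.col
      rw [← h4, hδ, h4, ← h1, hγ, h1, hβ] at h5
      omega
    · have h5 := hk δ.col
      rw [hδ, β.vec_of_lt_col h4, γ.vec_of_lt_col (h1 ▸ h4)] at h5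
      omega
  · right
    refine ⟨?_, h1⟩
    have h2 := hk β.col
    rw [hβ, γ.vec_of_lt_col h1, zero_add] at h2
    rcases lt_trichotomy δ.col β.col with h3 | h3 | h3
    · have h5 := hk δ.col
      rw [hδ, γ.vec_of_lt_col (h3.trans h1), β.vec_of_lt_col h3] at h5
      omega
    · exact h3
    · rw [δ.vec_of_lt_col h3] at h2
      omega

theorem weight_of_rootVector_ne_zero {α : PosRoot n T} {a b : Fin (size T n)}
    (h : rootVector F α a b ≠ 0) : weight b - weight a = α.vec := by
  rw [rootVector_eq, Matrix.sub_apply, Matrix.single_apply, Matrix.single_apply] at h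
  rw [α.vec_eq_weight_sub]
  by_cases h1 : rowIdx α = a ∧ colIdx α = b
  · rw [h1.1, h1.2]
  · by_cases h2 : (colIdx α).rev = a ∧ (rowIdx α).rev = b
    · rw [← h2.1, ← h2.2, weight_rev, weight_rev]
      abel
    · simp [h1, h2] at h

theorem rootVector_ne_zero {δ : PosRoot n T} {a b : Fin (size T n)}
    (h : weight b - weight a = δ.vec) : rootVector F δ a b ≠ 0 := by
  have hc := colIdx_lt_rowIdx δ
  rw [rootVector_eq, Matrix.sub_apply, Matrix.single_apply, Matrix.single_apply]
  rcases δ.eq_idx_of_weight_sub_eq h with ⟨rfl, rfl⟩ | ⟨rfl, rfl⟩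
  · have : ¬ ((colIdx δ).rev = rowIdx δ ∧ (rowIdx δ).rev = colIdx δ) := fun h => hc.2.ne h.1.symm
    simp [this]
  · have : ¬ (rowIdx δ = (colIdx δ).rev ∧ colIdx δ = (rowIdx δ).rev) := fun h => hc.2.ne h.1
    simp [this]

theorem weight_of_mul_rootVector_ne_zero {γ δ : PosRoot n T} {a b : Fin (size T n)}
    (h : (rootVector F γ * rootVector F δ) a b ≠ 0) :
    weight b - weight a = γ.vec + δ.vec := by
  rw [Matrix.mul_apply] at h
  obtain ⟨c, -, hc⟩ := Finset.exists_ne_zero_of_sum_ne_zero h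
  rw [← weight_of_rootVector_ne_zero (left_ne_zero_of_mul hc),
    ← weight_of_rootVector_ne_zero (right_ne_zero_of_mul hc)]
  abel

theorem commutator_rootVector_eq_zero {γ δ β : PosRoot n T} (h : γ.vec + δ.vec ≠ β.vec) :
    (rootVector F γ * rootVector F δ - rootVector F δ * rootVector F γ) (rowIdx β) (colIdx β) =
      0 := by
  rw [Matrix.sub_apply]
  have h1 : (rootVector F γ * rootVector F δ) (rowIdx β) (colIdx β) = 0 := by
    by_contra hne
    exact h (by rw [← weight_of_mul_rootVector_ne_zero hne, β.vec_eq_weight_sub])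
  have h2 : (rootVector F δ * rootVector F γ) (rowIdx β) (colIdx β) = 0 := by
    by_contra hne
    exact h (by rw [add_comm, ← weight_of_mul_rootVector_ne_zero hne, β.vec_eq_weight_sub])
  rw [h1, h2, sub_zero]

/-- Only `e_δ e_γ` contributes to this entry, and only through the first matrix unit of `e_γ`: the
value is `-e_δ (rowIdx β) (rowIdx γ)`, an entry at a place of weight `δ`. -/
theorem commutator_rootVector_ne_zero {γ δ β : PosRoot n T} (h : γ.vec + δ.vec = β.vec)
    (hcol : γ.col = β.col) :
    (rootVector F γ * rootVector F δ - rootVector F δ * rootVector F γ) (rowIdx β) (colIdx β) ≠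
      0 := by
  have hidx : colIdx γ = colIdx β := congrArg (pos T) hcol
  have hγ := colIdx_lt_rowIdx γ
  have h1 : (rootVector F γ * rootVector F δ) (rowIdx β) (colIdx β) = 0 := by
    rw [Matrix.mul_apply]
    refine Finset.sum_eq_zero fun c _ => ?_
    rw [mul_eq_zero]
    by_contra! hne
    -- The coefficient of `δ` at `β.col` is zero, so `e_δ` has no entry in the column of `e_β`.
    have hw := congrFun (weight_of_rootVector_ne_zero hne.2) β.col
    have hv := congrFun h β.col
    rw [Pi.add_apply, β.vec_col, ← hcol, γ.vec_col, hcol] at hv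
    rw [Pi.sub_apply, show δ.vec β.col = 0 by omega,
      (weight_eq_one_iff (colIdx β) β.col).2 rfl] at hw
    have hc : c = colIdx β := (weight_eq_one_iff c β.col).1 (by omega)
    exact hne.2 ((rootVector_mem δ).1 _ _ hc.le)
  have h2 : (rootVector F δ * rootVector F γ) (rowIdx β) (colIdx β) =
      rootVector F δ (rowIdx β) (rowIdx γ) := by
    have he : ∀ c, rootVector F γ c (colIdx γ) = if rowIdx γ = c then 1 else 0 := by
      intro c
      have : (rowIdx γ).rev ≠ colIdx γ := by
        intro he
        rw [← he, Fin.rev_rev] at hγ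
        exact hγ.2.ne rfl
      rw [rootVector_eq, Matrix.sub_apply, Matrix.single_apply, Matrix.single_apply]
      simp [this]
    rw [Matrix.mul_apply, ← hidx]
    simp [he]
  rw [Matrix.sub_apply, h1, h2, zero_sub, neg_ne_zero]
  apply rootVector_ne_zero
  rw [β.vec_eq_weight_sub, γ.vec_eq_weight_sub, hidx] at h
  linear_combination -h

end Weights

/-! ### The bracket form of the canonical form -/

section BracketMatrix

variable {F : Type*} [Field F] {T : RootType} {n : ℕ}

theorem canonicalForm_bracket (D : Finset (PosRoot n T)) (ξ : PosRoot n T → F)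
    (γ δ : PosRoot n T) :
    bracketForm (canonicalForm D ξ) ⟨_, rootVector_mem γ⟩ ⟨_, rootVector_mem δ⟩ =
      ∑ β ∈ D, ξ β * (rootVector F γ * rootVector F δ - rootVector F δ * rootVector F γ)
        (rowIdx β) (colIdx β) := by
  simp only [bracketForm_apply, canonicalForm, LinearMap.sum_apply, LinearMap.smul_apply,
    smul_eq_mul]
  rfl

theorem exists_add_eq_of_bracket_ne_zero {D : Finset (PosRoot n T)} {ξ : PosRoot n T → F}
    {γ δ : PosRoot n T}
    (h : bracketForm (canonicalForm D ξ) ⟨_, rootVector_mem γ⟩ ⟨_, rootVector_mem δ⟩ ≠ 0) :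
    ∃ β ∈ D, γ.vec + δ.vec = β.vec := by
  rw [canonicalForm_bracket] at h
  obtain ⟨β, hβ, hne⟩ := Finset.exists_ne_zero_of_sum_ne_zero h
  refine ⟨β, hβ, ?_⟩
  by_contra hv
  rw [commutator_rootVector_eq_zero hv, mul_zero] at hne
  exact hne rfl

theorem bracket_ne_zero {D : Finset (PosRoot n T)} {ξ : PosRoot n T → F}
    {γ δ β : PosRoot n T} (hβ : β ∈ D) (hξ : ξ β ≠ 0) (h : γ.vec + δ.vec = β.vec)
    (hcol : γ.col = β.col) :
    bracketForm (canonicalForm D ξ) ⟨_, rootVector_mem γ⟩ ⟨_, rootVector_mem δ⟩ ≠ 0 := by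
  rw [canonicalForm_bracket, Finset.sum_eq_single_of_mem β hβ]
  · exact mul_ne_zero hξ (commutator_rootVector_ne_zero h hcol)
  · intro β' _ hne
    rw [commutator_rootVector_eq_zero, mul_zero]
    rw [h]
    exact fun he => hne (PosRoot.vec_injective he).symm

end BracketMatrix

/-! ### The combinatorics of the battleship -/

section Battleship

variable {n : ℕ} {T : RootType}

/-- `γ` and `δ` receive a plus and a minus, respectively, when the column `k` is treated. -/
def IsSumPair (D : Finset (PosRoot n T)) (k : ℕ) (γ δ : PosRoot n T) : Prop :=
  (∃ β ∈ D, (β.col : ℕ) = k ∧ γ.vec + δ.vec = β.vec ∧ γ.col = β.col) ∧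
    battleshipAux D k γ ≠ .minus ∧ battleshipAux D k δ ≠ .minus

open Classical in
theorem battleshipAux_succ (D : Finset (PosRoot n T)) (k : ℕ) (α : PosRoot n T) :
    battleshipAux D (k + 1) α = if ∃ δ, IsSumPair D k α δ then .plus
      else if ∃ γ, IsSumPair D k γ α then .minus else battleshipAux D k α :=
  rfl

variable {D : Finset (PosRoot n T)} {j k : ℕ} {α γ δ : PosRoot n T}

theorem IsSumPair.col_left (h : IsSumPair D k γ δ) : (γ.col : ℕ) = k := by
  obtain ⟨⟨β, _, rfl, _, hc⟩, _⟩ := h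
  rw [hc]

theorem IsSumPair.lt_col_right (h : IsSumPair D k γ δ) : k < (δ.col : ℕ) := by
  obtain ⟨⟨β, _, rfl, hs, hc⟩, _⟩ := h
  rcases PosRoot.col_of_add_eq hs with h | h
  · exact h.2
  · exact absurd hc h.2.ne'

theorem IsSumPair.lt (h : IsSumPair D k γ δ) : k < n :=
  h.lt_col_right.trans δ.col.2

theorem battleshipAux_minus_succ (h : battleshipAux D k α = .minus) :
    battleshipAux D (k + 1) α = .minus := by
  rw [battleshipAux_succ, if_neg (fun ⟨_, hp⟩ => hp.2.1 h), if_neg (fun ⟨_, hp⟩ => hp.2.2 h), h]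

theorem battleshipAux_minus_mono (hjk : j ≤ k) (h : battleshipAux D j α = .minus) :
    battleshipAux D k α = .minus := by
  induction k, hjk using Nat.le_induction with
  | base => exact h
  | succ k _ ih => exact battleshipAux_minus_succ ih

theorem IsSumPair.minus_right (h : IsSumPair D k γ δ) (hkj : k < j) :
    battleshipAux D j δ = .minus := by
  refine battleshipAux_minus_mono (Nat.succ_le_of_lt hkj) ?_
  rw [Nat.succ_eq_add_one, battleshipAux_succ, if_neg, if_pos ⟨γ, h⟩]
  rintro ⟨_, h'⟩
  exact h.lt_col_right.ne' h'.col_left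

theorem IsSumPair.plus_left (h : IsSumPair D k γ δ) (hkj : k < j) :
    battleshipAux D j γ = .plus := by
  induction j, Nat.succ_le_of_lt hkj using Nat.le_induction with
  | base => rw [Nat.succ_eq_add_one, battleshipAux_succ, if_pos ⟨δ, h⟩]
  | succ j hj ih =>
    rw [battleshipAux_succ, ih hj]
    split_ifs with h1 h2
    · rfl
    · obtain ⟨γ', h'⟩ := h2
      have := h'.lt_col_right
      rw [h.col_left] at this
      omega
    · rfl

theorem exists_isSumPair_of_battleshipAux_eq (α : PosRoot n T) (j : ℕ) :
    (battleshipAux D j α = .plus → ∃ k δ, IsSumPair D k α δ) ∧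
      (battleshipAux D j α = .minus → ∃ k γ, IsSumPair D k γ α) := by
  induction j with
  | zero =>
    rw [battleshipAux]
    split_ifs <;> simp
  | succ j ih =>
    rw [battleshipAux_succ]
    split_ifs with h1 h2
    · exact ⟨fun _ => ⟨j, h1⟩, by simp⟩
    · exact ⟨by simp, fun _ => ⟨j, h2⟩⟩
    · exact ih

theorem battleship_eq_plus_iff : battleship D α = .plus ↔ ∃ k δ, IsSumPair D k α δ :=
  ⟨(exists_isSumPair_of_battleshipAux_eq α n).1, fun ⟨_, _, h⟩ => h.plus_left h.lt⟩

theorem battleship_eq_minus_iff : battleship D α = .minus ↔ ∃ k γ, IsSumPair D k γ α :=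
  ⟨(exists_isSumPair_of_battleshipAux_eq α n).2, fun ⟨_, _, h⟩ => h.minus_right h.lt⟩

theorem IsSumPair.step_unique {γ' : PosRoot n T} (h : IsSumPair D j γ δ)
    (h' : IsSumPair D k γ' δ) : j = k := by
  rcases lt_trichotomy j k with hlt | heq | hlt
  · exact absurd (h.minus_right hlt) h'.2.2
  · exact heq
  · exact absurd (h'.minus_right hlt) h.2.2

theorem IsSumPair.add_eq (hD : ∀ α ∈ D, ∀ β ∈ D, α.col = β.col → α = β)
    (h : IsSumPair D k γ δ) {β : PosRoot n T} (hβ : β ∈ D)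
    (hk : (β.col : ℕ) = k) : γ.vec + δ.vec = β.vec := by
  obtain ⟨⟨β', hβ', hk', hs, _⟩, _⟩ := h
  rw [hs, hD β' hβ' β hβ (Fin.ext (hk'.trans hk.symm))]

theorem IsSumPair.right_unique (hD : ∀ α ∈ D, ∀ β ∈ D, α.col = β.col → α = β)
    {δ' : PosRoot n T} (h : IsSumPair D j γ δ)
    (h' : IsSumPair D k γ δ') : δ = δ' := by
  obtain rfl : j = k := h.col_left.symm.trans h'.col_left
  obtain ⟨β, hβ, hk, hs, _⟩ := h.1
  have := h'.add_eq hD hβ hk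
  exact PosRoot.vec_injective (add_left_cancel (hs.trans this.symm))

theorem IsSumPair.left_unique (hD : ∀ α ∈ D, ∀ β ∈ D, α.col = β.col → α = β)
    {γ' : PosRoot n T} (h : IsSumPair D j γ δ)
    (h' : IsSumPair D k γ' δ) : γ = γ' := by
  obtain rfl := h.step_unique h'
  obtain ⟨β, hβ, hk, hs, _⟩ := h.1
  have := h'.add_eq hD hβ hk
  exact PosRoot.vec_injective (add_right_cancel (hs.trans this.symm))

/-- The minuses form a vertex cover: if neither `γ` nor `δ` were a minus at the end, neither would
have been one when the column of `β` was treated, and one of them would have become a minus then. -/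
theorem minus_of_add_mem {β : PosRoot n T} (hβ : β ∈ D)
    (h : γ.vec + δ.vec = β.vec) : battleship D γ = .minus ∨ battleship D δ = .minus := by
  wlog hc : γ.col = β.col generalizing γ δ
  · rw [or_comm]
    exact this (by rw [add_comm, h]) ((PosRoot.col_of_add_eq h).resolve_left fun h' => hc h'.1).1
  by_contra! hne
  have hp : IsSumPair D β.col γ δ :=
    ⟨⟨β, hβ, rfl, h, hc⟩, fun h' => hne.1 (battleshipAux_minus_mono β.col.2.le h'),
      fun h' => hne.2 (battleshipAux_minus_mono β.col.2.le h')⟩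
  exact hne.2 (battleship_eq_minus_iff.2 ⟨_, _, hp⟩)

/-- Triangularity. If `γ + δ' = β` with `γ` in the column of `β`, then `β` is the root of `D`
treated at the step of `γ`, so `δ'` is the partner of `γ`. Otherwise `δ'` lies in the column of `β`,
left of that of `γ`, and minuses are only placed to the right of the current column. -/
theorem IsSumPair.eq_or_step_lt (hD : ∀ α ∈ D, ∀ β ∈ D, α.col = β.col → α = β)
    {δ' γ' β : PosRoot n T} (h : IsSumPair D j γ δ)
    (h' : IsSumPair D k γ' δ') (hβ : β ∈ D) (hs : γ.vec + δ'.vec = β.vec) :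
    δ' = δ ∨ k < j := by
  rcases PosRoot.col_of_add_eq hs with hc | hc
  · left
    have := h.add_eq hD hβ (by rw [← hc.1, h.col_left])
    exact PosRoot.vec_injective (add_left_cancel (hs.trans this.symm))
  · right
    have h1 := h'.lt_col_right
    have h2 : (β.col : ℕ) < γ.col := hc.2
    rw [h.col_left, ← hc.1] at h2
    exact h1.trans h2

theorem ncard_plus_eq_ncard_minus (hD : ∀ α ∈ D, ∀ β ∈ D, α.col = β.col → α = β) :
    {α | battleship D α = .plus}.ncard =
    {α | battleship D α = .minus}.ncard := by
  simp only [battleship_eq_plus_iff, battleship_eq_minus_iff]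
  refine Set.ncard_congr (fun α h => h.choose_spec.choose) ?_ ?_ ?_
  · intro α h
    exact ⟨_, _, h.choose_spec.choose_spec⟩
  · intro α β hα hβ he
    exact hα.choose_spec.choose_spec.left_unique hD (he ▸ hβ.choose_spec.choose_spec)
  · rintro δ ⟨k, γ, h⟩
    have h' : ∃ k δ, IsSumPair D k γ δ := ⟨k, δ, h⟩
    exact ⟨γ, h', h'.choose_spec.choose_spec.right_unique hD h⟩

theorem ncard_plus_or_minus (hD : ∀ α ∈ D, ∀ β ∈ D, α.col = β.col → α = β) :
    {α | battleship D α = .plus ∨ battleship D α = .minus}.ncard =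
    2 * {α | battleship D α = .minus}.ncard := by
  rw [Set.ofPred_or, Set.ncard_union_eq, ncard_plus_eq_ncard_minus hD, two_mul]
  rw [Set.disjoint_left]
  intro α h h'
  exact absurd (h.symm.trans h') (by simp)

end Battleship

/-! ### The size of the orbit of the canonical form -/

section OrbitSize

variable {F : Type*} [Field F] {n : ℕ} {T : RootType}

/-- The coordinates on `𝔲` given by the basis of root vectors. -/
noncomputable def rootCoordinates (h2 : (2 : F) ≠ 0) [Fintype (PosRoot n T)] :
    (PosRoot n T → F) ≃ₗ[F] nilradical F T n :=
  LinearEquiv.ofBijective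
    (Fintype.linearCombination F fun α : PosRoot n T =>
      (⟨rootVector F α, rootVector_mem α⟩ : nilradical F T n)) <| by
    classical
    constructor
    · intro c d h
      ext α
      have := congrArg (dualVector F α) h
      simp only [Fintype.linearCombination_apply, map_sum, map_smul, dualVector_rootVector,
        smul_eq_mul, mul_ite, mul_one, mul_zero, Finset.sum_ite_eq, Finset.mem_univ,
        if_true] at this
      exact this
    · rw [← LinearMap.range_eq_top, Fintype.range_linearCombination,
        ← Submodule.map_injective_of_injective (nilradical F T n).subtype_injective |>.eq_iff,
        Submodule.map_span, ← Set.range_comp, Submodule.map_top, Submodule.range_subtype]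
      exact (nilradical_eq_span h2).symm

theorem rootCoordinates_apply (h2 : (2 : F) ≠ 0) [Fintype (PosRoot n T)] (c : PosRoot n T → F) :
    rootCoordinates h2 c = ∑ α, c α •
      (⟨rootVector F α, rootVector_mem α⟩ : nilradical F T n) := rfl

theorem ncard_coadjointOrbit [Finite F] (h2 : (2 : F) ≠ 0) (D : Finset (PosRoot n T))
    (hD : ∀ α ∈ D, ∀ β ∈ D, α.col = β.col → α = β) (ξ : PosRoot n T → F)
    (hξ : ∀ β ∈ D, ξ β ≠ 0) :
    (coadjointOrbit (canonicalForm D ξ)).ncard =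
      Nat.card F ^ (2 * {α | battleship D α = .minus}.ncard) := by
  classical
  have : Fintype (PosRoot n T) := Fintype.ofFinite _
  set f := canonicalForm D ξ
  let M : Matrix (PosRoot n T) (PosRoot n T) F := Matrix.of fun γ δ =>
    bracketForm f ⟨_, rootVector_mem γ⟩ ⟨_, rootVector_mem δ⟩
  let N : Finset (PosRoot n T) := {α | battleship D α = .minus}
  have hN : ∀ d : N, ∃ k γ, IsSumPair D k γ d := fun d =>
    battleship_eq_minus_iff.1 (Finset.mem_filter.1 d.2).2
  choose s π hπ using hN
  have hcard : {α | battleship D α = .minus}.ncard = N.card := by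
    rw [Set.ncard_eq_toFinset_card']
    congr 1
    ext α
    simp [N]
  have hrank := finrank_ker_of_matched_cover M
    (fun a b => by
      show bracketForm f _ _ = -bracketForm f _ _
      rw [bracketForm_apply, bracketForm_apply, ← map_neg]
      congr 1
      ext1
      exact (neg_sub _ _).symm)
    N
    (fun a b ha hb => by
      by_contra hne
      obtain ⟨β, hβ, hs⟩ := exists_add_eq_of_bracket_ne_zero hne
      rcases minus_of_add_mem hβ hs with h | h
      · exact ha (by simp [N, h])
      · exact hb (by simp [N, h]))
    π
    (fun d hd => by
      have h1 := (Finset.mem_filter.1 hd).2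
      have h2 := battleship_eq_plus_iff.2 ⟨_, _, hπ d⟩
      exact absurd (h1.symm.trans h2) (by simp))
    s
    (fun d => by
      obtain ⟨⟨β, hβ, _, hs, hc⟩, _⟩ := hπ d
      exact bracket_ne_zero hβ (hξ β hβ) hs hc)
    (fun d d' hne => by
      obtain ⟨β, hβ, hs⟩ := exists_add_eq_of_bracket_ne_zero hne
      exact ((hπ d).eq_or_step_lt hD (hπ d') hβ hs).imp Subtype.ext id)
  let e := rootCoordinates (n := n) (T := T) h2
  have hker : Nat.card (LinearMap.ker (bracketForm f).flip) =
      Nat.card (LinearMap.ker M.mulVecLin) := by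
    refine (Nat.card_congr (Equiv.subtypeEquiv e.toEquiv fun c => ?_)).symm
    have hM : ∀ γ, M.mulVecLin c γ = bracketForm f ⟨_, rootVector_mem γ⟩ (e c) := by
      intro γ
      rw [rootCoordinates_apply, map_sum]
      exact Finset.sum_congr rfl fun δ _ => by rw [map_smul, smul_eq_mul, mul_comm]; rfl
    rw [LinearMap.mem_ker, LinearMap.mem_ker]
    constructor
    · intro h
      ext z
      obtain ⟨d, rfl⟩ := e.surjective z
      rw [LinearMap.flip_apply, rootCoordinates_apply, map_sum, LinearMap.sum_apply]
      refine Finset.sum_eq_zero fun γ _ => ?_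
      rw [map_smul, LinearMap.smul_apply]
      exact smul_eq_zero_of_right _ ((hM γ).symm.trans (congrFun h γ))
    · intro h
      ext γ
      rw [hM]
      exact LinearMap.congr_fun h _
  have horb := ncard_coadjointOrbit_mul h2 f
  have hu : Nat.card (nilradical F T n) = Nat.card F ^ Fintype.card (PosRoot n T) := by
    rw [← Nat.card_congr e.toEquiv, Nat.card_fun, Nat.card_eq_fintype_card (α := PosRoot n T)]
  rw [hker, hu, Module.natCard_eq_pow_finrank (K := F), ← hrank, pow_add, mul_comm] at horb
  rw [hcard]
  exact Nat.eq_of_mul_eq_mul_left (pow_pos Nat.card_pos _) horb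

end OrbitSize

end OrthRook

theorem corollary3p8 {F : Type*} [Field F] [Finite F] (p : ℕ) [CharP F p] (hp2 : p ≠ 2)
    (T : OrthRook.RootType) (n : ℕ) (hpn : n ≤ p)
    (D : Finset (OrthRook.PosRoot n T)) (hD : OrthRook.IsOrthogonalRookPlacement D)
    (ξ : OrthRook.PosRoot n T → F) (hξ : ∀ β ∈ D, ξ β ≠ 0) :
    OrthRook.orbitDim (OrthRook.coadjointOrbit (OrthRook.canonicalForm D ξ)) =
        ({α | OrthRook.battleship D α = .plus ∨ OrthRook.battleship D α = .minus} :
          Set (OrthRook.PosRoot n T)).ncard ∧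
      OrthRook.orbitDim (OrthRook.coadjointOrbit (OrthRook.canonicalForm D ξ)) =
        2 * ({α | OrthRook.battleship D α = .minus} : Set (OrthRook.PosRoot n T)).ncard := by
  have h2 : (2 : F) ≠ 0 := Ring.two_ne_zero (by rwa [ringChar.eq F p])
  have hcol : ∀ α ∈ D, ∀ β ∈ D, α.col = β.col → α = β := fun α hα β hβ h => by
    by_contra hne
    exact (hD α hα β hβ hne).2.2 h
  have hq : (1 : ℝ) < Nat.card F := by exact_mod_cast Finite.one_lt_card
  have hdim : OrthRook.orbitDim (OrthRook.coadjointOrbit (OrthRook.canonicalForm D ξ)) =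
      2 * ({α | OrthRook.battleship D α = .minus} : Set (OrthRook.PosRoot n T)).ncard := by
    rw [OrthRook.orbitDim, OrthRook.ncard_coadjointOrbit h2 D hcol ξ hξ, Nat.cast_pow,
      Real.logb_pow, Real.logb_self_eq_one hq]
    push_cast
    ring
  refine ⟨?_, hdim⟩
  rw [hdim, OrthRook.ncard_plus_or_minus hcol]
  push_cast
  rfl
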